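/- Let $n,p\ge 1$ and let $\mathbf{x}_{1},\dots,\mathbf{x}_{n}\in\mathbb{R}^p$ be pairwise distinct (for instance, the coefficient vectors $\mathbf{x}_{i,p}$ of a functional sample $\mathcal{X}_1,\dots,\mathcal{X}_n$ on an arbitrary $p$-truncated basis of a separable Hilbert space). For $i,j,r\in\{1,\dots,n\}$ let $A_{ijr}$ be the surface area of $$S_{ijr}=\{\mathbf{z}\in\mathbb{S}^{p-1} : (\mathbf{x}_i-\mathbf{x}_r)'\mathbf{z}\le 0,\ (\mathbf{x}_j-\mathbf{x}_r)'\mathbf{z}\le 0\},$$ where $\mathbb{S}^{p-1}$ is the Euclidean unit sphere of $\mathbb{R}^p$ with its unnormalized surface measure (the counting measure if $p=1$), and let $\mathbf{A}_\bullet$ be the $n\times n$ matrix with entries $(\mathbf{A}_\bullet)_{ij}=\sum_{r=1}^n A_{ijr}$. Then $$A_{ijr}=A_{ijr}^{(\measuredangle)}\,\frac{\pi^{p/2-1}}{\Gamma(p/2)},\qquad A_{ijr}^{(\measuredangle)}=\begin{cases}2\pi,&\mathbf{x}_i=\mathbf{x}_j=\mathbf{x}_r,\\ \pi,&\mathbf{x}_i\ne\mathbf{x}_j\text{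 and }(\mathbf{x}_i=\mathbf{x}_r\text{ or }\mathbf{x}_j=\mathbf{x}_r),\\ \pi-\cos^{-1}\!\left(\dfrac{(\mathbf{x}_i-\mathbf{x}_r)'(\mathbf{x}_j-\mathbf{x}_r)}{\|\mathbf{x}_i-\mathbf{x}_r\|\,\|\mathbf{x}_j-\mathbf{x}_r\|}\right),&\text{otherwise},\end{cases}$$ for all $i,j,r$; the matrix $\mathbf{A}_\bullet$ is (symmetric) positive definite; and consequently $\|\mathbf{v}\|_{\mathbf{A}_\bullet}:=(\mathbf{v}'\mathbf{A}_\bullet\mathbf{v})^{1/2}$ is a norm on $\mathbb{R}^n$. -/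

import Mathlib

/-- The region of all unit vectors `z` of `ℝᵖ` such that `(xᵢ - xᵣ)ᵀ z ≤ 0` and
`(xⱼ - xᵣ)ᵀ z ≤ 0`, i.e. `z` makes an angle of at least `π / 2` with both differences (no condition
is imposed by a difference that vanishes). -/
def wedgeRegion {n p : ℕ} (x : Fin n → EuclideanSpace ℝ (Fin p)) (i j r : Fin n) :
    Set (Metric.sphere (0 : EuclideanSpace ℝ (Fin p)) 1) :=
  {z | inner ℝ (x i - x r) (z : EuclideanSpace ℝ (Fin p)) ≤ 0 ∧
       inner ℝ (x j - x r) (z : EuclideanSpace ℝ (Fin p)) ≤ 0}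

/-- `A_{ijr}`: the surface area of the spherical region `wedgeRegion x i j r`. The measure
`volume.toSphere` is the (unnormalized) surface measure of the unit sphere, of total mass
`2 π ^ (p / 2) / Γ (p / 2)`. -/
noncomputable def wedgeArea {n p : ℕ} (x : Fin n → EuclideanSpace ℝ (Fin p)) (i j r : Fin n) : ℝ :=
  (MeasureTheory.volume : MeasureTheory.Measure (EuclideanSpace ℝ (Fin p))).toSphere.real
    (wedgeRegion x i j r)

open scoped Classical in
/-- `A_{ijr}^{(∡)}`: `2π`, `π`, or the opening angle of the spherical wedge. -/
noncomputable def wedgeAngle {n p : ℕ} (x : Fin n → EuclideanSpace ℝ (Fin p)) (i j r : Fin n) : ℝ :=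
  if x i = x j ∧ x j = x r then 2 * Real.pi
  else if x i ≠ x j ∧ (x i = x r ∨ x j = x r) then Real.pi
  else Real.pi -
    Real.arccos (inner ℝ (x i - x r) (x j - x r) / (‖x i - x r‖ * ‖x j - x r‖))

/-- The matrix `A_•`, with entries `∑ᵣ A_{ijr}`. -/
noncomputable def Abullet {n p : ℕ} (x : Fin n → EuclideanSpace ℝ (Fin p)) :
    Matrix (Fin n) (Fin n) ℝ :=
  Matrix.of fun i j => ∑ r : Fin n, wedgeArea x i j r

/-- The functional `v ↦ (vᵀ A v) ^ (1 / 2)` on `ℝⁿ`. -/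
noncomputable def weightedNorm {n : ℕ} (A : Matrix (Fin n) (Fin n) ℝ) (v : Fin n → ℝ) : ℝ :=
  Real.sqrt (dotProduct v (A.mulVec v))

/-- `f` is a norm on the real vector space `ℝⁿ`. -/
structure IsNormOnRn {n : ℕ} (f : (Fin n → ℝ) → ℝ) : Prop where
  nonneg : ∀ v, 0 ≤ f v
  eq_zero_iff : ∀ v, f v = 0 ↔ v = 0
  smul : ∀ (c : ℝ) (v : Fin n → ℝ), f (c • v) = |c| * f v
  triangle : ∀ v w, f (v + w) ≤ f v + f w

/-! Area formula: the surface area of a set of directions is `p` times the volume of the part of the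
unit ball in the cone over it. For independent `a`, `b`, slice the ball parallel to their span: each
slice is a disc, of which the two half planes cut out the fraction `(π - angle a b) / (2π)`, so by
Fubini the ball has the same fraction (`measure_ball_inter_wedge`).

Definiteness: the quadratic form is `∑ r, ∫ (∑ i, v i · 1[⟪x i, z⟫ ≤ ⟪x r, z⟫])² dz`
(`dotProduct_Abullet_mulVec`). If it vanishes, then for almost every `z` all these cumulative sums
are zero. Almost every `z` also separates the points `x i`; one such `z` makes the sums a triangular
system, so `v = 0`. -/

theorem measurableSet_inner_nonpos {E : Type*} [NormedAddCommGroup E] [InnerProductSpace ℝ E]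
    [MeasurableSpace E] [OpensMeasurableSpace E] (a : E) :
    MeasurableSet {x : E | inner ℝ a x ≤ 0} :=
  (isClosed_le (by fun_prop) continuous_const).measurableSet

theorem measurableSet_inner_nonpos_and {E : Type*} [NormedAddCommGroup E] [InnerProductSpace ℝ E]
    [MeasurableSpace E] [OpensMeasurableSpace E] (a b : E) :
    MeasurableSet {x : E | inner ℝ a x ≤ 0 ∧ inner ℝ b x ≤ 0} :=
  (measurableSet_inner_nonpos a).inter (measurableSet_inner_nonpos b)

/-! ### Planar sectors -/

/-- The area of a planar region that is described, in polar coordinates, by a radial bound and a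
set of angles. -/
theorem volume_radial_inter_sector {D : Set ℂ} (hD : MeasurableSet D) {T : Set ℝ}
    (hT : MeasurableSet T) (hTD : ∀ r θ : ℝ, 0 < r → θ ∈ Set.Ioo (-Real.pi) Real.pi →
      ((r * (Real.cos θ + Real.sin θ * Complex.I) : ℂ) ∈ D ↔ θ ∈ T)) (R : ℝ) :
    MeasureTheory.volume ({z : ℂ | ‖z‖ ^ 2 < R} ∩ D) =
      (∫⁻ r in Set.Ioi (0 : ℝ), ENNReal.ofReal r * ({r : ℝ | r ^ 2 < R}.indicator 1 r)) *
        MeasureTheory.volume (T ∩ Set.Ioo (-Real.pi) Real.pi) := by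
  have hR : MeasurableSet {z : ℂ | ‖z‖ ^ 2 < R} :=
    measurableSet_lt (by fun_prop) (by fun_prop)
  have hR' : MeasurableSet {r : ℝ | r ^ 2 < R} :=
    measurableSet_lt (by fun_prop) (by fun_prop)
  rw [← MeasureTheory.lintegral_indicator_one (hR.inter hD),
    ← Complex.lintegral_comp_polarCoord_symm]
  have htarget : polarCoord.target = Set.Ioi (0 : ℝ) ×ˢ Set.Ioo (-Real.pi) Real.pi := rfl
  have hvol : MeasureTheory.volume (T ∩ Set.Ioo (-Real.pi) Real.pi) =
      ∫⁻ θ in Set.Ioo (-Real.pi) Real.pi, T.indicator 1 θ := by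
    rw [MeasureTheory.lintegral_indicator_one hT, MeasureTheory.Measure.restrict_apply hT]
  rw [hvol, ← MeasureTheory.lintegral_prod_mul
    (f := fun r => ENNReal.ofReal r * {r : ℝ | r ^ 2 < R}.indicator 1 r)
    (ENNReal.measurable_ofReal.mul (measurable_one.indicator hR')).aemeasurable
    (measurable_one.indicator hT).aemeasurable,
    MeasureTheory.Measure.prod_restrict, htarget]
  refine MeasureTheory.setLIntegral_congr_fun (measurableSet_Ioi.prod measurableSet_Ioo) ?_
  rintro ⟨r, θ⟩ ⟨hr, hθ⟩
  have hr' : 0 < r := hr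
  have h2 := hTD r θ hr' hθ
  have h1 : ‖(r * (Real.cos θ + Real.sin θ * Complex.I) : ℂ)‖ ^ 2 = r ^ 2 := by
    have := Complex.norm_polarCoord_symm (r, θ)
    rw [Complex.polarCoord_symm_apply] at this
    rw [this, sq_abs]
  simp only [Complex.polarCoord_symm_apply, smul_eq_mul, mul_assoc]
  congr 1
  by_cases ha : r ^ 2 < R <;> by_cases hb : θ ∈ T <;>
    simp only [Set.indicator, Set.mem_inter_iff, Set.mem_ofPred_eq, h1, h2, ha, hb, and_self,
      and_true, and_false, if_true, if_false, Pi.one_apply, mul_one,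
      mul_zero]

theorem cos_sub_nonneg_and_cos_add_nonneg_iff {t θ : ℝ} (ht : |t| ≤ Real.pi / 2)
    (hθ : θ ∈ Set.Ioo (-Real.pi) Real.pi) :
    (0 ≤ Real.cos (θ - t) ∧ 0 ≤ Real.cos (θ + t)) ↔ |θ| ≤ Real.pi / 2 - |t| := by
  have hpi := Real.pi_pos
  have key : ∀ s φ : ℝ, 0 ≤ s → s ≤ Real.pi / 2 → 0 ≤ φ → φ < Real.pi →
      ((0 ≤ Real.cos (φ - s) ∧ 0 ≤ Real.cos (φ + s)) ↔ φ ≤ Real.pi / 2 - s) := by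
    intro s φ hs hs2 hφ hφ2
    constructor
    · rintro ⟨-, h⟩
      by_contra hlt
      push Not at hlt
      exact absurd h (not_le.2 (Real.cos_neg_of_pi_div_two_lt_of_lt (by linarith) (by linarith)))
    · intro h
      exact ⟨Real.cos_nonneg_of_neg_pi_div_two_le_of_le (by linarith) (by linarith),
        Real.cos_nonneg_of_neg_pi_div_two_le_of_le (by linarith) (by linarith)⟩
  -- Both sides depend only on `|t|` and `|θ|`: a sign change at most swaps the two cosines.
  have h := key |t| |θ| (abs_nonneg _) ht (abs_nonneg _) (abs_lt.2 hθ)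
  rw [← h]
  rcases abs_cases t with ⟨h1, -⟩ | ⟨h1, -⟩ <;> rcases abs_cases θ with ⟨h2, -⟩ | ⟨h2, -⟩ <;>
    rw [h1, h2]
  · rw [← Real.cos_neg (θ - t), ← Real.cos_neg (θ + t), and_comm]; ring_nf
  · rw [and_comm]; ring_nf
  · rw [← Real.cos_neg (θ - t), ← Real.cos_neg (θ + t)]; ring_nf

/-- The part of a disc cut out by two half planes through its centre has area proportional to the
opening angle. -/
theorem volume_disc_inter_halfPlanes {u v : ℂ} (hu : u ≠ 0) (hv : v ≠ 0) (R : ℝ) :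
    MeasureTheory.volume ({z : ℂ | ‖z‖ ^ 2 < R} ∩ {z | inner ℝ u z ≤ 0 ∧ inner ℝ v z ≤ 0}) =
      ENNReal.ofReal ((Real.pi - InnerProductGeometry.angle u v) / (2 * Real.pi)) *
        MeasureTheory.volume {z : ℂ | ‖z‖ ^ 2 < R} := by
  have hpi := Real.pi_pos
  -- `-w` bisects the angle between `u` and `v`, and `t` is half the signed angle `arg (u / v)`.
  -- Rotating by `w` makes the wedge symmetric about the positive real axis.
  obtain ⟨w, t, hw, ht, hangle, huw, hvw⟩ : ∃ (w : ℂ) (t : ℝ), ‖w‖ = 1 ∧ |t| ≤ Real.pi / 2 ∧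
      InnerProductGeometry.angle u v = 2 * |t| ∧
      (u = -(‖u‖ * (w * Complex.exp (t * Complex.I)))) ∧
      (v = -(‖v‖ * (w * Complex.exp (-(t * Complex.I))))) := by
    have hu' : (‖u‖ : ℂ) ≠ 0 := by simpa using hu
    have hv' : (‖v‖ : ℂ) ≠ 0 := by simpa using hv
    refine ⟨-(v / ‖v‖ * Complex.exp (((u / v).arg / 2 : ℝ) * Complex.I)), (u / v).arg / 2,
      ?_, ?_, ?_, ?_, ?_⟩
    · rw [norm_neg, norm_mul, Complex.norm_exp_ofReal_mul_I, norm_div]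
      simp [hv]
    · rw [abs_div, abs_two]
      linarith [Complex.abs_arg_le_pi (u / v)]
    · rw [Complex.angle_eq_abs_arg hu hv, abs_div, abs_two]; ring
    · have h := Complex.norm_mul_exp_arg_mul_I (u / v)
      have h2 : Complex.exp (((u / v).arg / 2 : ℝ) * Complex.I) *
          Complex.exp (((u / v).arg / 2 : ℝ) * Complex.I) =
          Complex.exp ((u / v).arg * Complex.I) := by
        rw [← Complex.exp_add]; congr 1; push_cast; ring
      rw [neg_mul, mul_assoc, h2]
      rw [norm_div, Complex.ofReal_div] at h
      field_simp at h ⊢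
      linear_combination (-1) * h
    · rw [neg_mul, mul_assoc, ← Complex.exp_add, add_neg_cancel, Complex.exp_zero]
      field_simp
  have hD := measurableSet_inner_nonpos_and u v
  let w' : Circle := ⟨w, by simp [Submonoid.unitSphere, hw]⟩
  have hww : w * (starRingEnd ℂ) w = 1 := by
    rw [Complex.mul_conj, Complex.normSq_eq_norm_sq, hw]; norm_num
  have hrot := (rotation w').measurePreserving
  have hR : MeasurableSet {z : ℂ | ‖z‖ ^ 2 < R} :=
    measurableSet_lt (by fun_prop) (by fun_prop)
  have hinner : ∀ (c : ℂ) (s : ℝ), c = -(‖c‖ * (w * Complex.exp (s * Complex.I))) →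
      ∀ r θ : ℝ, inner ℝ c (w * (r * (Real.cos θ + Real.sin θ * Complex.I))) =
        -(‖c‖ * r * Real.cos (θ - s)) := by
    intro c s hc r θ
    generalize ‖c‖ = k at hc ⊢
    subst hc
    rw [Complex.inner]
    have : w * (r * (Real.cos θ + Real.sin θ * Complex.I)) *
        (starRingEnd ℂ) (-(k * (w * Complex.exp (s * Complex.I)))) =
        (w * (starRingEnd ℂ) w) * (-(k * r) * ((Real.cos θ + Real.sin θ * Complex.I) *
        (starRingEnd ℂ) (Complex.exp (s * Complex.I)))) := by
      simp only [map_neg, map_mul, Complex.conj_ofReal]; ring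
    rw [this, hww, one_mul, Real.cos_sub, Complex.exp_mul_I, ← Complex.ofReal_cos,
      ← Complex.ofReal_sin]
    simp only [map_add, map_mul, Complex.conj_ofReal, Complex.conj_I, Complex.mul_re,
      Complex.add_re, Complex.add_im, Complex.neg_re, Complex.neg_im, Complex.ofReal_re,
      Complex.ofReal_im, Complex.I_re, Complex.I_im, Complex.mul_im]
    ring
  rw [← hrot.measure_preimage (hR.inter hD).nullMeasurableSet]
  have hpre : rotation w' ⁻¹' ({z : ℂ | ‖z‖ ^ 2 < R} ∩ {z | inner ℝ u z ≤ 0 ∧ inner ℝ v z ≤ 0}) =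
      {z : ℂ | ‖z‖ ^ 2 < R} ∩ (rotation w' ⁻¹' {z | inner ℝ u z ≤ 0 ∧ inner ℝ v z ≤ 0}) := by
    ext z
    rw [Set.preimage_inter, Set.mem_inter_iff, Set.mem_inter_iff, Set.mem_preimage,
      Set.mem_ofPred_eq, LinearIsometryEquiv.norm_map]; rfl
  have hT : MeasurableSet {θ : ℝ | |θ| ≤ Real.pi / 2 - |t|} :=
    measurableSet_le (by fun_prop) (by fun_prop)
  -- The full disc has the same radial integral, which therefore never needs to be evaluated.
  have h2 := volume_radial_inter_sector MeasurableSet.univ MeasurableSet.univ (by simp) R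
  rw [Set.inter_univ, Set.univ_inter, Real.volume_Ioo] at h2
  rw [hpre, volume_radial_inter_sector (hrot.measurable hD) hT _ R, h2, mul_left_comm,
    ← ENNReal.ofReal_mul (by rw [hangle]; apply div_nonneg <;> linarith)]
  · congr 1
    have hset : {θ : ℝ | |θ| ≤ Real.pi / 2 - |t|} ∩ Set.Ioo (-Real.pi) Real.pi =
        Set.Icc (-(Real.pi / 2 - |t|)) (Real.pi / 2 - |t|) := by
      ext θ
      simp only [Set.mem_inter_iff, Set.mem_ofPred_eq, abs_le, Set.mem_Ioo, Set.mem_Icc]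
      have := abs_nonneg t
      constructor
      · exact fun h => h.1
      · exact fun h => ⟨h, by linarith, by linarith⟩
    rw [hset, Real.volume_Icc, hangle]
    congr 1
    field_simp
  · intro r θ hr hθ
    have hu1 := hinner u t huw r θ
    have hv1 := hinner v (-t) (by simpa using hvw) r θ
    rw [sub_neg_eq_add] at hv1
    simp only [Set.mem_preimage, rotation_apply, Set.mem_ofPred_eq]
    change inner ℝ u (w * _) ≤ 0 ∧ inner ℝ v (w * _) ≤ 0 ↔ _
    rw [hu1, hv1, ← cos_sub_nonneg_and_cos_add_nonneg_iff ht hθ, neg_nonpos, neg_nonpos,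
      mul_nonneg_iff_of_pos_left (by positivity), mul_nonneg_iff_of_pos_left (by positivity)]

/-! ### Wedges of the unit ball -/

theorem measure_ball_inter_preimage_fst {E F : Type*} [NormedAddCommGroup E]
    [InnerProductSpace ℝ E] [FiniteDimensional ℝ E] [MeasurableSpace E] [BorelSpace E]
    [NormedAddCommGroup F] [InnerProductSpace ℝ F] [FiniteDimensional ℝ F] [MeasurableSpace F]
    [BorelSpace F] (μ : MeasureTheory.Measure E) [μ.IsAddHaarMeasure] (e : E ≃L[ℝ] ℂ × F)
    (he : ∀ x, ‖x‖ ^ 2 = ‖(e x).1‖ ^ 2 + ‖(e x).2‖ ^ 2) {D : Set ℂ} (hD : MeasurableSet D)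
    {κ : ENNReal} (hκ : ∀ R : ℝ, MeasureTheory.volume ({z : ℂ | ‖z‖ ^ 2 < R} ∩ D) =
      κ * MeasureTheory.volume {z : ℂ | ‖z‖ ^ 2 < R}) :
    μ (Metric.ball 0 1 ∩ {x | (e x).1 ∈ D}) = κ * μ (Metric.ball 0 1) := by
  let ν : MeasureTheory.Measure (ℂ × F) := MeasureTheory.volume.prod MeasureTheory.volume
  -- By uniqueness of Haar measure `e` carries `μ` to a multiple of the product measure; the factor
  -- appears on both sides of the claim.
  have hmap : μ.map e = (μ.map e).addHaarScalarFactor ν • ν :=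
    MeasureTheory.Measure.isAddLeftInvariant_eq_smul _ _
  have hme : MeasurableEmbedding e := e.toHomeomorph.measurableEmbedding
  have hB : MeasurableSet {q : ℂ × F | ‖q.1‖ ^ 2 + ‖q.2‖ ^ 2 < 1} :=
    measurableSet_lt (by fun_prop) (by fun_prop)
  have hball : Metric.ball (0 : E) 1 = e ⁻¹' {q : ℂ × F | ‖q.1‖ ^ 2 + ‖q.2‖ ^ 2 < 1} := by
    ext x
    rw [Set.mem_preimage, Set.mem_ofPred_eq, ← he, mem_ball_zero_iff, sq_lt_one_iff₀ (norm_nonneg _)]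
  have hprod : ν ({q : ℂ × F | ‖q.1‖ ^ 2 + ‖q.2‖ ^ 2 < 1} ∩ Prod.fst ⁻¹' D) =
      κ * ν {q : ℂ × F | ‖q.1‖ ^ 2 + ‖q.2‖ ^ 2 < 1} := by
    rw [MeasureTheory.Measure.prod_apply_symm (hB.inter (measurable_fst hD)),
      MeasureTheory.Measure.prod_apply_symm hB,
      ← MeasureTheory.lintegral_const_mul _ (measurable_measure_prodMk_right hB)]
    refine MeasureTheory.lintegral_congr fun y => ?_
    -- The slice over `y` has squared radius `1 - ‖y‖ ^ 2`; when this is not positive the slice is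
    -- empty, which `hκ` also covers.
    convert hκ (1 - ‖y‖ ^ 2) using 2
    · ext z; simp [lt_sub_iff_add_lt]
    · congr 1; ext z; simp [lt_sub_iff_add_lt]
  have hset : Metric.ball (0 : E) 1 ∩ {x | (e x).1 ∈ D} =
      e ⁻¹' ({q : ℂ × F | ‖q.1‖ ^ 2 + ‖q.2‖ ^ 2 < 1} ∩ Prod.fst ⁻¹' D) := by
    rw [hball]; rfl
  rw [hset, hball, ← hme.map_apply, ← hme.map_apply, hmap, MeasureTheory.Measure.smul_apply,
    MeasureTheory.Measure.smul_apply, hprod, mul_smul_comm]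

section
variable {E : Type*} [NormedAddCommGroup E] [InnerProductSpace ℝ E] [FiniteDimensional ℝ E]
  [MeasurableSpace E] [BorelSpace E] (μ : MeasureTheory.Measure E) [μ.IsAddHaarMeasure]

theorem measure_inner_eq_zero {a : E} (ha : a ≠ 0) : μ {x | inner ℝ a x = 0} = 0 := by
  have h : {x | inner ℝ a x = 0} = (((ℝ ∙ a)ᗮ : Submodule ℝ E) : Set E) := by
    ext x; simp [Submodule.mem_orthogonal_singleton_iff_inner_right]
  rw [h]
  refine MeasureTheory.Measure.addHaar_submodule μ _ fun htop => ha ?_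
  have : a ∈ (ℝ ∙ a)ᗮ := htop ▸ Submodule.mem_top
  simpa [Submodule.mem_orthogonal_singleton_iff_inner_right] using this

theorem measure_ball_inter_halfSpace {a : E} (ha : a ≠ 0) :
    μ (Metric.ball 0 1 ∩ {x | inner ℝ a x ≤ 0}) = 2⁻¹ * μ (Metric.ball 0 1) := by
  have hm : MeasurableSet {x : E | inner ℝ a x ≤ 0} := measurableSet_inner_nonpos a
  have hsplit := MeasureTheory.measure_inter_add_sdiff (μ := μ) (Metric.ball 0 1) hm
  have hneg : μ (Metric.ball 0 1 \ {x | inner ℝ a x ≤ 0}) =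
      μ (Metric.ball 0 1 ∩ {x | inner ℝ a x ≤ 0}) := by
    -- The reflection `x ↦ -x` swaps the two half balls up to the null hyperplane.
    rw [← MeasureTheory.Measure.measure_preimage_neg μ (Metric.ball 0 1 \ _)]
    refine MeasureTheory.measure_congr ?_
    have h0 : ∀ᵐ x ∂μ, inner ℝ a x ≠ 0 := by
      rw [MeasureTheory.ae_iff]; simpa using measure_inner_eq_zero μ ha
    filter_upwards [h0] with x hx
    refine propext ?_
    change (-x ∈ Metric.ball 0 1 ∧ ¬ inner ℝ a (-x) ≤ 0) ↔ (x ∈ Metric.ball 0 1 ∧ inner ℝ a x ≤ 0)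
    rw [mem_ball_zero_iff, mem_ball_zero_iff, norm_neg, inner_neg_right, neg_nonpos, not_le,
      hx.le_iff_lt]
  rw [hneg, ← two_mul] at hsplit
  rw [← hsplit, ← mul_assoc, ENNReal.inv_mul_cancel (by simp) (by simp), one_mul]

/-- The part of the unit ball cut out by two half spaces through its centre has measure
proportional to the opening angle. -/
theorem measure_ball_inter_wedge {a b : E} (ha : a ≠ 0) (hb : b ≠ 0) :
    μ (Metric.ball 0 1 ∩ {x | inner ℝ a x ≤ 0 ∧ inner ℝ b x ≤ 0}) =
      ENNReal.ofReal ((Real.pi - InnerProductGeometry.angle a b) / (2 * Real.pi)) *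
        μ (Metric.ball 0 1) := by
  have hpi := Real.pi_pos
  by_cases hli : LinearIndependent ℝ ![a, b]
  · let K : Submodule ℝ E := Submodule.span ℝ (Set.range ![a, b])
    have haK : a ∈ K := Submodule.subset_span ⟨0, rfl⟩
    have hbK : b ∈ K := Submodule.subset_span ⟨1, rfl⟩
    have hK : Module.finrank ℝ K = 2 := by simpa using finrank_span_eq_card hli
    let f : K ≃ₗᵢ[ℝ] ℂ :=
      (Complex.isometryOfOrthonormal ((stdOrthonormalBasis ℝ K).reindex (finCongr hK))).symm
    let e : E ≃L[ℝ] ℂ × Kᗮ :=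
      (K.orthogonalDecomposition.toContinuousLinearEquiv.trans
        (WithLp.prodContinuousLinearEquiv 2 ℝ K Kᗮ)).trans
        (f.toContinuousLinearEquiv.prodCongr (ContinuousLinearEquiv.refl ℝ Kᗮ))
    have he1 : ∀ x, (e x).1 = f (K.orthogonalProjectionOnto x) := fun x => by simp [e]
    have he2 : ∀ x, (e x).2 = Kᗮ.orthogonalProjectionOnto x := fun x => by simp [e]
    have hin : ∀ c : K, ∀ x, inner ℝ (c : E) x = inner ℝ (f c) (e x).1 := by
      intro c x
      rw [he1, f.inner_map_map, Submodule.inner_orthogonalProjectionOnto_eq_of_mem_left]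
    have hD := measurableSet_inner_nonpos_and (f ⟨a, haK⟩) (f ⟨b, hbK⟩)
    have hangle : InnerProductGeometry.angle (f ⟨a, haK⟩) (f ⟨b, hbK⟩) =
        InnerProductGeometry.angle a b := by
      simp [InnerProductGeometry.angle]
    have h := measure_ball_inter_preimage_fst μ e
      (fun x => by
        rw [he1, he2, f.norm_map]
        exact K.norm_sq_eq_add_norm_sq_projection x) hD
      (volume_disc_inter_halfPlanes (by simpa using ha) (by simpa using hb))
    rw [hangle] at h
    rw [← h]
    congr 2
    ext x
    simp only [Set.mem_ofPred_eq, ← hin]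
  -- Parallel normals span no plane: opposite ones leave a null hyperplane, codirectional ones a
  -- half space.
  · rw [LinearIndependent.pair_iff' ha] at hli
    push Not at hli
    obtain ⟨c, rfl⟩ := hli
    have hc : c ≠ 0 := by rintro rfl; simp at hb
    rcases hc.lt_or_gt with hc | hc
    · rw [InnerProductGeometry.angle_smul_right_of_neg _ _ hc, InnerProductGeometry.angle_neg_right,
        InnerProductGeometry.angle_self ha, sub_zero, sub_self, zero_div, ENNReal.ofReal_zero,
        zero_mul]
      refine MeasureTheory.measure_mono_null ?_ (measure_inner_eq_zero μ ha)
      rintro x ⟨-, h1, h2⟩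
      rw [inner_smul_left] at h2
      exact le_antisymm h1 (nonneg_of_mul_nonpos_right h2 hc)
    · rw [InnerProductGeometry.angle_smul_right_of_pos _ _ hc, InnerProductGeometry.angle_self ha,
        sub_zero]
      have hset : {x : E | inner ℝ a x ≤ 0 ∧ inner ℝ (c • a) x ≤ 0} = {x | inner ℝ a x ≤ 0} := by
        ext x
        simp only [Set.mem_ofPred_eq, inner_smul_left, and_iff_left_iff_imp]
        exact fun h => mul_nonpos_of_nonneg_of_nonpos hc.le h
      rw [hset, measure_ball_inter_halfSpace μ ha]
      congr 1
      rw [show Real.pi / (2 * Real.pi) = 2⁻¹ by field_simp, ENNReal.ofReal_inv_of_pos two_pos]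
      simp
end

/-! ### From the ball to the sphere -/

section
variable {E : Type*} [NormedAddCommGroup E] [InnerProductSpace ℝ E] [FiniteDimensional ℝ E]
  [MeasurableSpace E] [BorelSpace E] (μ : MeasureTheory.Measure E) [μ.IsAddHaarMeasure]

open scoped Pointwise in
/-- The surface measure of a set of unit directions, in terms of the part of the unit ball in the
cone that the set spans. -/
theorem toSphere_real_preimage_coe [Nontrivial E] {C : Set E} (hC : MeasurableSet C)
    (hsmul : ∀ (r : ℝ) (x : E), 0 < r → (r • x ∈ C ↔ x ∈ C)) :
    μ.toSphere.real {z : Metric.sphere (0 : E) 1 | (z : E) ∈ C} =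
      Module.finrank ℝ E * μ.real (Metric.ball 0 1 ∩ C) := by
  have hset : Set.Ioo (0 : ℝ) 1 • (Subtype.val '' {z : Metric.sphere (0 : E) 1 | (z : E) ∈ C}) =
      (Metric.ball 0 1 ∩ C) \ {0} := by
    ext y
    simp only [Set.mem_smul, Set.mem_image, Set.mem_ofPred_eq, Set.mem_sdiff, Set.mem_inter_iff,
      mem_ball_zero_iff, Set.mem_singleton_iff]
    constructor
    · rintro ⟨r, hr, _, ⟨z, hz, rfl⟩, rfl⟩
      have hz1 : ‖(z : E)‖ = 1 := by simp
      refine ⟨⟨?_, (hsmul r _ hr.1).2 hz⟩, smul_ne_zero hr.1.ne' ?_⟩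
      · rw [norm_smul, hz1, mul_one, Real.norm_of_nonneg hr.1.le]; exact hr.2
      · rw [← norm_ne_zero_iff, hz1]; exact one_ne_zero
    · rintro ⟨⟨h1, hy⟩, h0⟩
      have hpos : 0 < ‖y‖ := norm_pos_iff.2 h0
      refine ⟨‖y‖, ⟨hpos, h1⟩, ‖y‖⁻¹ • y, ⟨⟨‖y‖⁻¹ • y, ?_⟩,
        (hsmul _ _ (inv_pos.2 hpos)).2 hy, rfl⟩, smul_inv_smul₀ hpos.ne' y⟩
      rw [mem_sphere_zero_iff_norm, norm_smul, norm_inv, norm_norm, inv_mul_cancel₀ hpos.ne']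
  rw [MeasureTheory.measureReal_def, MeasureTheory.Measure.toSphere_apply' μ
    (s := {z : Metric.sphere (0 : E) 1 | (z : E) ∈ C}) (measurable_subtype_coe hC), hset,
    MeasureTheory.measure_sdiff_null
    (MeasureTheory.measure_singleton _), ENNReal.toReal_mul, ENNReal.toReal_natCast,
    MeasureTheory.measureReal_def]

/-- The cone over the exceptional directions lies in the exceptional set of `E`, which is null. -/
theorem ae_toSphere_of_smul_invariant {p : E → Prop} (hp : MeasurableSet {x | p x})
    (hsmul : ∀ (r : ℝ) (x : E), 0 < r → (p (r • x) ↔ p x)) (h : ∀ᵐ x ∂μ, p x) :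
    ∀ᵐ z : Metric.sphere (0 : E) 1 ∂μ.toSphere, p z := by
  rcases subsingleton_or_nontrivial E with hE | hE
  · rw [(μ.toSphere_eq_zero_iff).2 hE]; simp
  rw [MeasureTheory.ae_iff] at h ⊢
  have := toSphere_real_preimage_coe μ hp.compl fun r x hr => not_congr (hsmul r x hr)
  rw [MeasureTheory.measureReal_def _ (_ ∩ _), MeasureTheory.measure_mono_null
    (Set.inter_subset_right (t := {x | p x}ᶜ)) h, ENNReal.toReal_zero, mul_zero] at this
  exact (MeasureTheory.measureReal_eq_zero_iff).1 this

theorem toSphere_ae_inner_ne_zero {a : E} (ha : a ≠ 0) :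
    ∀ᵐ z : Metric.sphere (0 : E) 1 ∂μ.toSphere, inner ℝ a (z : E) ≠ 0 := by
  refine ae_toSphere_of_smul_invariant μ (p := fun x => inner ℝ a x ≠ 0) ?_ ?_ ?_
  · exact ((isClosed_eq (by fun_prop) continuous_const : IsClosed {x : E | inner ℝ a x = 0})
      |>.measurableSet).compl
  · intro r x hr
    simp [inner_smul_right, hr.ne']
  · rw [MeasureTheory.ae_iff]; simpa using measure_inner_eq_zero μ ha
end

theorem finrank_mul_volume_real_ball (p : ℕ) (hp : 1 ≤ p) :
    p * MeasureTheory.volume.real (Metric.ball (0 : EuclideanSpace ℝ (Fin p)) 1) =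
      2 * Real.pi * (Real.pi ^ ((p : ℝ) / 2 - 1) / Real.Gamma ((p : ℝ) / 2)) := by
  have : Nonempty (Fin p) := ⟨⟨0, hp⟩⟩
  have hp' : (0 : ℝ) < p := by exact_mod_cast hp
  have hpi := Real.pi_pos
  have hG : Real.Gamma ((p : ℝ) / 2) ≠ 0 := (Real.Gamma_pos_of_pos (by positivity)).ne'
  have hsqrt : √Real.pi ^ p = Real.pi ^ ((p : ℝ) / 2) := by
    rw [Real.sqrt_eq_rpow, ← Real.rpow_natCast, ← Real.rpow_mul hpi.le]; ring_nf
  rw [MeasureTheory.measureReal_def, EuclideanSpace.volume_ball, Fintype.card_fin,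
    ENNReal.ofReal_one, one_pow, one_mul, Real.Gamma_add_one (by positivity), hsqrt,
    ENNReal.toReal_ofReal (by have := Real.Gamma_pos_of_pos (half_pos hp'); positivity),
    Real.rpow_sub_one hpi.ne']
  field_simp

theorem wedgeArea_eq {n p : ℕ} (hp : 1 ≤ p) (x : Fin n → EuclideanSpace ℝ (Fin p))
    (i j r : Fin n) :
    wedgeArea x i j r =
      wedgeAngle x i j r * (Real.pi ^ ((p : ℝ) / 2 - 1) / Real.Gamma ((p : ℝ) / 2)) := by
  have : Nonempty (Fin p) := ⟨⟨0, hp⟩⟩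
  have hpi := Real.pi_pos
  let μ : MeasureTheory.Measure (EuclideanSpace ℝ (Fin p)) := MeasureTheory.volume
  have harea : wedgeArea x i j r = p * μ.real (Metric.ball 0 1 ∩
      {z | inner ℝ (x i - x r) z ≤ 0 ∧ inner ℝ (x j - x r) z ≤ 0}) := by
    have := toSphere_real_preimage_coe μ (measurableSet_inner_nonpos_and (x i - x r) (x j - x r))
      (fun c z hc => by
        simp only [Set.mem_ofPred_eq, inner_smul_right, ← not_lt, mul_pos_iff_of_pos_left hc])
    rwa [finrank_euclideanSpace_fin] at this
  have hhalf : ∀ a : EuclideanSpace ℝ (Fin p), a ≠ 0 →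
      p * μ.real (Metric.ball 0 1 ∩ {z | inner ℝ a z ≤ 0}) =
        Real.pi * (Real.pi ^ ((p : ℝ) / 2 - 1) / Real.Gamma ((p : ℝ) / 2)) := by
    intro a ha
    have := finrank_mul_volume_real_ball p hp
    rw [MeasureTheory.measureReal_def] at this
    rw [MeasureTheory.measureReal_def, measure_ball_inter_halfSpace μ ha, ENNReal.toReal_mul,
      ENNReal.toReal_inv, ENNReal.toReal_ofNat]
    linarith
  rw [harea, wedgeAngle]
  split_ifs with h1 h2
  · obtain ⟨h1, h2⟩ := h1
    rw [← finrank_mul_volume_real_ball p hp]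
    simp [h1, h2, μ]
  · obtain ⟨hij, h | h⟩ := h2
    · rw [← hhalf (x j - x r) (sub_ne_zero.2 (h ▸ hij.symm))]
      simp [h]
    · rw [← hhalf (x i - x r) (sub_ne_zero.2 (h ▸ hij))]
      simp [h]
  -- The remaining case includes `x i = x j ≠ x r`, where the angle is `0`.
  · have hi : x i ≠ x r := fun h => by
      by_cases hij : x i = x j
      · exact h1 ⟨hij, hij ▸ h⟩
      · exact h2 ⟨hij, Or.inl h⟩
    have hj : x j ≠ x r := fun h => by
      by_cases hij : x i = x j
      · exact h1 ⟨hij, h⟩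
      · exact h2 ⟨hij, Or.inr h⟩
    have hle := InnerProductGeometry.angle_le_pi (x i - x r) (x j - x r)
    rw [MeasureTheory.measureReal_def, measure_ball_inter_wedge μ (sub_ne_zero.2 hi)
      (sub_ne_zero.2 hj), ENNReal.toReal_mul, ENNReal.toReal_ofReal
        (div_nonneg (by linarith) (by linarith)), mul_left_comm, ← MeasureTheory.measureReal_def,
      finrank_mul_volume_real_ball p hp, InnerProductGeometry.angle]
    field_simp

/-! ### Positive definiteness and the norm -/

/-- If the cumulative sums of `v`, in the order of the distinct values `y`, vanish, so does `v`. -/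
theorem eq_zero_of_sum_ite_le_eq_zero {ι : Type*} [Fintype ι] {y : ι → ℝ}
    (hy : Function.Injective y) {v : ι → ℝ} (h : ∀ r, ∑ i, (if y i ≤ y r then v i else 0) = 0) :
    v = 0 := by
  by_contra hv
  have hne : (Finset.univ.filter fun i => v i ≠ 0).Nonempty := by
    obtain ⟨i, hi⟩ := Function.ne_iff.1 hv
    exact ⟨i, by simpa using hi⟩
  -- At the index of the support of `v` with least `y`, the cumulative sum has the single term `v
  -- r`.
  obtain ⟨r, hr, hmin⟩ := Finset.exists_min_image _ y hne
  have hr' : v r ≠ 0 := by simpa using hr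
  refine hr' ?_
  rw [← h r, Finset.sum_eq_single r]
  · simp
  · intro i _ hir
    by_cases hvi : v i = 0
    · simp [hvi]
    · have hle := hmin i (by simpa using hvi)
      exact if_neg (not_le.2 (lt_of_le_of_ne hle fun he => hir (hy he).symm))
  · simp

/-- Expanding the square, the product of the indicators for `i` and `j` is the indicator of
`wedgeRegion x i j r`, which integrates to `wedgeArea x i j r`. -/
theorem dotProduct_Abullet_mulVec {n p : ℕ} (x : Fin n → EuclideanSpace ℝ (Fin p))
    (v : Fin n → ℝ) :
    dotProduct v ((Abullet x).mulVec v) =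
      ∑ r, ∫ z : Metric.sphere (0 : EuclideanSpace ℝ (Fin p)) 1,
        (∑ i, if inner ℝ (x i) z.1 ≤ inner ℝ (x r) z.1
          then v i else 0) ^ 2 ∂MeasureTheory.volume.toSphere := by
  have hreg : ∀ i j r, MeasurableSet (wedgeRegion x i j r) := fun i j r =>
    measurable_subtype_coe (measurableSet_inner_nonpos_and (x i - x r) (x j - x r))
  have hexp : ∀ (r : Fin n) (z : Metric.sphere (0 : EuclideanSpace ℝ (Fin p)) 1),
      (∑ i, if inner ℝ (x i) z.1 ≤ inner ℝ (x r) z.1 then v i else 0) ^ 2 =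
        ∑ i, ∑ j, (wedgeRegion x i j r).indicator (fun _ => v i * v j) z := by
    intro r z
    rw [sq, Finset.sum_mul_sum]
    refine Finset.sum_congr rfl fun i _ => Finset.sum_congr rfl fun j _ => ?_
    simp only [wedgeRegion, Set.indicator, Set.mem_ofPred_eq, inner_sub_left, sub_nonpos]
    split_ifs <;> simp_all
  have hint : ∀ i j r, MeasureTheory.Integrable
      ((wedgeRegion x i j r).indicator fun _ => v i * v j)
      (MeasureTheory.volume : MeasureTheory.Measure (EuclideanSpace ℝ (Fin p))).toSphere :=
    fun i j r => (MeasureTheory.integrable_const _).indicator (hreg i j r)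
  simp_rw [hexp]
  have hI : ∀ r, ∫ z, (∑ i, ∑ j, (wedgeRegion x i j r).indicator (fun _ => v i * v j) z)
      ∂(MeasureTheory.volume : MeasureTheory.Measure (EuclideanSpace ℝ (Fin p))).toSphere =
      ∑ i, ∑ j, wedgeArea x i j r * (v i * v j) := by
    intro r
    rw [MeasureTheory.integral_finsetSum _ fun i _ =>
      MeasureTheory.integrable_finsetSum _ fun j _ => hint i j r]
    refine Finset.sum_congr rfl fun i _ => ?_
    rw [MeasureTheory.integral_finsetSum _ fun j _ => hint i j r]
    refine Finset.sum_congr rfl fun j _ => ?_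
    rw [MeasureTheory.integral_indicator_const _ (hreg i j r), smul_eq_mul, wedgeArea]
  simp_rw [hI]
  rw [Finset.sum_comm]
  simp only [dotProduct, Matrix.mulVec, Abullet, Matrix.of_apply, Finset.mul_sum, Finset.sum_mul]
  refine Finset.sum_congr rfl fun i _ => ?_
  rw [Finset.sum_comm]
  exact Finset.sum_congr rfl fun j _ => Finset.sum_congr rfl fun r _ => by ring

theorem Abullet_posDef {n p : ℕ} (hp : 1 ≤ p) {x : Fin n → EuclideanSpace ℝ (Fin p)}
    (hx : Function.Injective x) : (Abullet x).PosDef := by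
  have : Nonempty (Fin p) := ⟨⟨0, hp⟩⟩
  refine Matrix.PosDef.of_dotProduct_mulVec_pos ?_ fun v hv => ?_
  · ext i j
    simp only [Matrix.conjTranspose_apply, Abullet, Matrix.of_apply, star_trivial]
    refine Finset.sum_congr rfl fun r _ => ?_
    simp only [wedgeArea, wedgeRegion, and_comm]
  have hnonneg : ∀ r ∈ Finset.univ, 0 ≤ ∫ z : Metric.sphere (0 : EuclideanSpace ℝ (Fin p)) 1,
      (∑ i, if inner ℝ (x i) z.1 ≤ inner ℝ (x r) z.1 then v i else 0) ^ 2
        ∂MeasureTheory.volume.toSphere :=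
    fun r _ => MeasureTheory.integral_nonneg fun z => sq_nonneg _
  rw [star_trivial, dotProduct_Abullet_mulVec]
  refine lt_of_le_of_ne (Finset.sum_nonneg hnonneg) fun h0 => hv ?_
  have hzero := (Finset.sum_eq_zero_iff_of_nonneg hnonneg).1 h0.symm
  have hae : ∀ᵐ z : Metric.sphere (0 : EuclideanSpace ℝ (Fin p)) 1
      ∂MeasureTheory.volume.toSphere, ∀ r,
        (∑ i, if inner ℝ (x i) z.1 ≤ inner ℝ (x r) z.1 then v i else 0) = 0 := by
    refine MeasureTheory.ae_all_iff.2 fun r => ?_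
    have hr := (MeasureTheory.integral_eq_zero_iff_of_nonneg (fun z => sq_nonneg _) ?_).1
      (hzero r (Finset.mem_univ r))
    · filter_upwards [hr] with z hz
      exact pow_eq_zero_iff two_ne_zero |>.1 hz
    · refine MeasureTheory.Integrable.of_bound (C := (∑ i, |v i|) ^ 2)
        (Measurable.aestronglyMeasurable ?_) (.of_forall fun z => ?_)
      · refine (Finset.measurable_sum _ fun i _ => Measurable.ite ?_ measurable_const
          measurable_const).pow_const 2
        exact (isClosed_le (by fun_prop) (by fun_prop)).measurableSet
      · rw [norm_pow]
        refine pow_le_pow_left₀ (norm_nonneg _) ((norm_sum_le _ _).trans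
          (Finset.sum_le_sum fun i _ => ?_)) 2
        split_ifs <;> simp
  have hinj : ∀ᵐ z : Metric.sphere (0 : EuclideanSpace ℝ (Fin p)) 1
      ∂MeasureTheory.volume.toSphere,
        ∀ i j, i ≠ j → inner ℝ (x i - x j) z.1 ≠ 0 := by
    refine MeasureTheory.ae_all_iff.2 fun i => MeasureTheory.ae_all_iff.2 fun j => ?_
    by_cases hij : i = j
    · simp [hij]
    · filter_upwards [toSphere_ae_inner_ne_zero MeasureTheory.volume
        (sub_ne_zero.2 (hx.ne hij))] with z hz _ using hz
  -- The surface measure is nonzero, so two almost sure properties share a direction `z`.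
  have : Filter.NeBot (MeasureTheory.ae
      (MeasureTheory.volume : MeasureTheory.Measure (EuclideanSpace ℝ (Fin p))).toSphere) :=
    MeasureTheory.ae_neBot.2 (MeasureTheory.Measure.toSphere_ne_zero _)
  obtain ⟨z, hz, hz'⟩ := (hae.and hinj).exists
  refine eq_zero_of_sum_ite_le_eq_zero (y := fun i => inner ℝ (x i) z.1) ?_ hz
  intro i j hij
  by_contra hne
  exact hz' i j hne (by rw [inner_sub_left, sub_eq_zero]; exact hij)

theorem isNormOnRn_weightedNorm {n : ℕ} {A : Matrix (Fin n) (Fin n) ℝ} (hA : A.PosDef) :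
    IsNormOnRn (weightedNorm A) where
  nonneg _ := Real.sqrt_nonneg _
  eq_zero_iff v := by
    constructor
    · intro h
      by_contra hv
      exact (Real.sqrt_pos.2 (star_trivial v ▸ hA.dotProduct_mulVec_pos hv)).ne' h
    · rintro rfl
      simp [weightedNorm]
  smul c v := by
    rw [weightedNorm, weightedNorm, Matrix.mulVec_smul, dotProduct_smul, smul_dotProduct,
      smul_eq_mul, smul_eq_mul, ← mul_assoc, Real.sqrt_mul (mul_self_nonneg c),
      Real.sqrt_mul_self_eq_abs]
  triangle v w := by
    -- The triangle inequality is that of the seminorm attached to a positive semidefinite matrix.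
    have h : ∀ u : Fin n → ℝ, weightedNorm A u =
        (A.toSeminormedAddCommGroup hA.posSemidef).norm u := fun u => by
      change √_ = √(RCLike.re (dotProduct (A.mulVec u) (star u)))
      rw [star_trivial, dotProduct_comm]; rfl
    rw [h, h, h]
    exact @norm_add_le _ (A.toSeminormedAddCommGroup hA.posSemidef).toSeminormedAddGroup v w

theorem lemma4 (n p : ℕ) (hn : 1 ≤ n) (hp : 1 ≤ p)
    (x : Fin n → EuclideanSpace ℝ (Fin p)) (hx : Function.Injective x) :
    (∀ i j r : Fin n,
      wedgeArea x i j r =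
        wedgeAngle x i j r * (Real.pi ^ ((p : ℝ) / 2 - 1) / Real.Gamma ((p : ℝ) / 2))) ∧
    (Abullet x).PosDef ∧
    IsNormOnRn (weightedNorm (Abullet x)) :=
  ⟨wedgeArea_eq hp x, Abullet_posDef hp hx, isNormOnRn_weightedNorm (Abullet_posDef hp hx)⟩
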